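/- \textbf{Theorem (Consistency of penalized MT-estimators).} \emph{Model.} Let $-\infty\le\mu_1<\mu_2\le+\infty$ and let $g:(\mu_1,\mu_2)\to\mathbb R$ be continuous and strictly increasing with $\lim_{\mu\to\mu_1}g(\mu)=-\infty$ and $\lim_{\mu\to\mu_2}g(\mu)=+\infty$. For every $\mu\in(\mu_1,\mu_2)$ let $F(\cdot,\mu,\phi)$ be a probability distribution on $\mathbb R$, where $\phi>0$ is a known scale parameter, let $a(\phi)>0$, and write $\mathbb E_\mu,\mathrm{Var}_\mu$ for moments under $y\sim F(\cdot,\mu,\phi)$. Let $t,\rho:\mathbb R\to\mathbb R$, and let $(y,\mathbf x),(y_1,\mathbf x_1),(y_2,\mathbf x_2),\dots$ be identically distributed random vectors in $\mathbb R\times\mathbb R^{p+1}$, with $(y_i,\mathbf x_i)_{i\ge1}$ independent, such that for some $\boldsymbol\beta_*\in\mathbb R^{p+1}$ the conditional law of $y$ given $\mathbf x$ is $F(\cdot,g^{-1}(\mathbf x^\top\boldsymbol\beta_*),\phi)$ (in particular $\mathbf x$ may be of the form $(1,\mathbf z^\top)^\top$). Put $$m(\mu)=\arg\min_{\gamma\in\mathbb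 R}\mathbb E_\mu\,\rho\!\left(\frac{t(y)-\gamma}{\sqrt{a(\phi)}}\right),\qquad L(\boldsymbol\beta)=\mathbb E\,\rho\!\left(\frac{t(y)-m(g^{-1}(\mathbf x^\top\boldsymbol\beta))}{\sqrt{a(\phi)}}\right),$$ $$L_n(\boldsymbol\beta)=\frac1n\sum_{i=1}^n\rho\!\left(\frac{t(y_i)-m(g^{-1}(\mathbf x_i^\top\boldsymbol\beta))}{\sqrt{a(\phi)}}\right),$$ and, with $S=\{\mathbf u\in\mathbb R^{p+1}:\|\mathbf u\|_2=1\}$, $$\tau=\inf_{\mathbf u\in S}\mathbb E\left(\lim_{\zeta\to\infty}\rho\!\left(\frac{t(y)-m(g^{-1}(\zeta\,\mathbf x^\top\mathbf u))}{\sqrt{a(\phi)}}\right)\right)-L(\boldsymbol\beta_*).$$ \emph{Assumptions.} (A1) $A:=\sup_{\mu}\mathrm{Var}_\mu(t(y))<\infty$. (A2) For every $\mu\in(\mu_1,\mu_2)$ the minimizer $m(\mu)$ exists and is unique, and $m$ is strictly increasing on $(\mu_1,\mu_2)$. (A3) $F(\cdot,\mu,\phi)$ is weakly continuous in $\mu\in(\mu_1,\mu_2)$.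 (A4) If $\nu_1<\nu_2$ in $(\mu_1,\mu_2)$, then $F(\cdot,\nu_1,\phi)$ is stochastically smaller than $F(\cdot,\nu_2,\phi)$. (A5) $t$ is strictly increasing and continuous. (B1) $\rho\ge0$, $\rho(0)=0$, $\rho(u)=\rho(-u)$. (B2) $\lim_{u\to\infty}\rho(u)=1$. (B3) $0\le u<v$ implies $\rho(u)\le\rho(v)$. (B4) $0\le u<v$ and $\rho(u)<1$ imply $\rho(u)<\rho(v)$. (B5) $\rho$ is continuous. (B6) There is $\eta>0$ with $\rho(A^{1/2}+\eta)<1$. (B8) $\inf_{\mathbf u\in S}\mathbb P(\mathbf u^\top\mathbf x\ne0)>1-\tau$. \emph{Penalty and estimator.} Let $P_{\lambda,\alpha}(\boldsymbol\beta)\in\mathbb R$ be a penalty depending on real parameters $\lambda,\alpha$, and let $\lambda_n,\alpha_n$ be possibly random, with almost surely $P_{\lambda_n,\alpha_n}(\boldsymbol\beta)\ge0$ for all $\boldsymbol\beta\in\mathbb R^{p+1}$ and all $n\ge1$, and $P_{\lambda_n,\alpha_n}(\boldsymbol\beta_*)\to0$ almost surely as $n\to\infty$. Suppose that, almost surely,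 for every $n\ge1$, $\hat{\boldsymbol\beta}_n$ is a minimizer over $\mathbb R^{p+1}$ of $L_n(\boldsymbol\beta)+P_{\lambda_n,\alpha_n}(\boldsymbol\beta)$. \emph{Conclusion.} Then $\hat{\boldsymbol\beta}_n\to\boldsymbol\beta_*$ almost surely. -/

import Mathlib

open MeasureTheory ProbabilityTheory Filter Topology

noncomputable section

namespace PenMT

/-- The range `(μ₁, μ₂)` of the mean parameter; the end points may be infinite. -/
def meanRange (μ₁ μ₂ : EReal) : Set ℝ :=
  {μ : ℝ | μ₁ < (μ : EReal) ∧ (μ : EReal) < μ₂}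

/-- `g` is a link function on `(μ₁, μ₂)`: it is continuous and strictly increasing there, it tends
to `-∞` at the left end point and to `+∞` at the right end point. (For `μ₁ = ⊥` the filter
`comap (↑) (𝓝[>] μ₁)` on `ℝ` is `atBot`, and for a real `μ₁` it is `𝓝[>] μ₁`; similarly on the
right.) -/
structure IsLink (μ₁ μ₂ : EReal) (g : ℝ → ℝ) : Prop where
  lt : μ₁ < μ₂
  continuousOn : ContinuousOn g (meanRange μ₁ μ₂)
  strictMonoOn : StrictMonoOn g (meanRange μ₁ μ₂)
  tendsto_left : Tendsto g (comap ((↑) : ℝ → EReal) (𝓝[>] μ₁)) atBot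
  tendsto_right : Tendsto g (comap ((↑) : ℝ → EReal) (𝓝[<] μ₂)) atTop

/-- The inverse `g⁻¹ : ℝ → (μ₁, μ₂)` of the link function. -/
def invLink (μ₁ μ₂ : EReal) (g : ℝ → ℝ) : ℝ → ℝ :=
  Function.invFunOn g (meanRange μ₁ μ₂)

/-- Bounded `ρ`-functions, normalised to have limit `1` at infinity. -/
structure IsRhoFunction (ρ : ℝ → ℝ) : Prop where
  nonneg : ∀ u, 0 ≤ ρ u
  zero : ρ 0 = 0
  even : ∀ u, ρ u = ρ (-u)
  tendsto_one : Tendsto ρ atTop (𝓝 1)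
  mono : ∀ u v, 0 ≤ u → u < v → ρ u ≤ ρ v
  strict : ∀ u v, 0 ≤ u → u < v → ρ u < 1 → ρ u < ρ v
  continuous : Continuous ρ

/-- `γ ↦ E (ρ ((t(y) - γ) / √s))` for a response `y` with law `ν`. -/
def locLoss (ρ t : ℝ → ℝ) (s : ℝ) (ν : ProbabilityMeasure ℝ) (γ : ℝ) : ℝ :=
  ∫ y, ρ ((t y - γ) / √s) ∂(ν : Measure ℝ)

/-- `m(μ) = argmin_γ E_μ (ρ ((t(y) - γ) / √s))`, where `F μ` is the law of `y` with parameter `μ`. -/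
def mFun (ρ t : ℝ → ℝ) (s : ℝ) (F : ℝ → ProbabilityMeasure ℝ) (μ : ℝ) : ℝ :=
  Classical.epsilon fun γ : ℝ => IsMinOn (locLoss ρ t s (F μ)) Set.univ γ

/-- `m(μ)` is univocally defined (the minimum is attained at exactly one point) for every
`μ ∈ (μ₁, μ₂)`, and `m` is strictly increasing on `(μ₁, μ₂)`. -/
def MUniqueStrictMono (ρ t : ℝ → ℝ) (s : ℝ) (F : ℝ → ProbabilityMeasure ℝ)
    (μ₁ μ₂ : EReal) : Prop :=
  (∀ μ ∈ meanRange μ₁ μ₂, ∃! γ : ℝ, IsMinOn (locLoss ρ t s (F μ)) Set.univ γ) ∧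
    StrictMonoOn (mFun ρ t s F) (meanRange μ₁ μ₂)

/-- `sup_μ Var_μ (t(y))`, as an extended nonnegative number; the variance is infinite
if `t(y)` is not square integrable. -/
def supVar (t : ℝ → ℝ) (F : ℝ → ProbabilityMeasure ℝ) (μ₁ μ₂ : EReal) : ENNReal :=
  ⨆ μ ∈ meanRange μ₁ μ₂, evariance t (F μ : Measure ℝ)

/-- The loss `ρ ((t(y) - m(g⁻¹(η))) / √s)` of a response `y` at the linear predictor `η`. -/
def mtLoss (ρ t : ℝ → ℝ) (s : ℝ) (F : ℝ → ProbabilityMeasure ℝ) (μ₁ μ₂ : EReal) (g : ℝ → ℝ)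
    (y η : ℝ) : ℝ :=
  ρ ((t y - mFun ρ t s F (invLink μ₁ μ₂ g η)) / √s)

section Regression

variable {Ω : Type*} [MeasurableSpace Ω] {p : ℕ}

/-- `(Y, X)` follows a generalized linear model with parameter `β`: given `X`, the response `Y`
has law `F (g⁻¹(Xᵀβ))`. -/
def FollowsGLM (P : Measure Ω) [IsFiniteMeasure P] (Y : Ω → ℝ)
    (X : Ω → EuclideanSpace ℝ (Fin (p + 1))) (F : ℝ → ProbabilityMeasure ℝ) (μ₁ μ₂ : EReal)
    (g : ℝ → ℝ) (β : EuclideanSpace ℝ (Fin (p + 1))) : Prop :=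
  ∀ᵐ w ∂(P.map X), condDistrib Y X P w = (F (invLink μ₁ μ₂ g (inner ℝ w β)) : Measure ℝ)

/-- The population objective `L(β) = E (ρ ((t(Y) - m(g⁻¹(Xᵀβ))) / √s))`. -/
def risk (ρ t : ℝ → ℝ) (s : ℝ) (F : ℝ → ProbabilityMeasure ℝ) (μ₁ μ₂ : EReal) (g : ℝ → ℝ)
    (P : Measure Ω) (Y : Ω → ℝ) (X : Ω → EuclideanSpace ℝ (Fin (p + 1)))
    (β : EuclideanSpace ℝ (Fin (p + 1))) : ℝ :=
  ∫ ω, mtLoss ρ t s F μ₁ μ₂ g (Y ω) (inner ℝ (X ω) β) ∂P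

/-- `τ = inf_{‖u‖ = 1} E (lim_{ζ → ∞} ρ ((t(Y) - m(g⁻¹(ζ Xᵀu))) / √s)) - L(β)`. -/
def tau (ρ t : ℝ → ℝ) (s : ℝ) (F : ℝ → ProbabilityMeasure ℝ) (μ₁ μ₂ : EReal) (g : ℝ → ℝ)
    (P : Measure Ω) (Y : Ω → ℝ) (X : Ω → EuclideanSpace ℝ (Fin (p + 1)))
    (β : EuclideanSpace ℝ (Fin (p + 1))) : ℝ :=
  (⨅ u : Metric.sphere (0 : EuclideanSpace ℝ (Fin (p + 1))) 1,
      ∫ ω, limUnder atTop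
        (fun ζ : ℝ => mtLoss ρ t s F μ₁ μ₂ g (Y ω) (ζ * inner ℝ (X ω) u.1)) ∂P)
    - risk ρ t s F μ₁ μ₂ g P Y X β

/-- `inf_{‖u‖ = 1} P (uᵀX ≠ 0)`. -/
def infNonzeroProb (P : Measure Ω) (X : Ω → EuclideanSpace ℝ (Fin (p + 1))) : ℝ :=
  ⨅ u : Metric.sphere (0 : EuclideanSpace ℝ (Fin (p + 1))) 1,
    P.real {ω | inner ℝ (X ω) u.1 ≠ 0}

/-- The empirical objective `L_n(β)` of the first `n` observations, at the sample point `ω`. -/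
def empRisk (ρ t : ℝ → ℝ) (s : ℝ) (F : ℝ → ProbabilityMeasure ℝ) (μ₁ μ₂ : EReal) (g : ℝ → ℝ)
    (y : ℕ → Ω → ℝ) (x : ℕ → Ω → EuclideanSpace ℝ (Fin (p + 1))) (n : ℕ) (ω : Ω)
    (β : EuclideanSpace ℝ (Fin (p + 1))) : ℝ :=
  (1 / (n : ℝ)) * ∑ i ∈ Finset.range n, mtLoss ρ t s F μ₁ μ₂ g (y i ω) (inner ℝ (x i ω) β)

end Regression

end PenMT

end

/-!
The argument is Wald's: away from `βstar` the empirical risk stays above the risk of `βstar`, while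
the penalized estimator has an empirical risk of at most `L_n(βstar) + P_n(βstar)`, which tends to
the risk of `βstar`.

* The map `η ↦ m(g⁻¹(η))` is continuous: `m` is monotone, and by weak continuity of the response
  laws every cluster point of its values near `μ` minimizes the expected loss under `μ`, so that it
  is `m(μ)` by uniqueness (`MUniqueStrictMono.continuousAt_mFun`). Hence the loss is continuous in
  `β`. Since `m(g⁻¹(·))` is monotone, the loss also has limits as the linear predictor tends
  to `±∞`.
* Conditionally on the covariates, `βstar` gives the unique minimizer of the expected loss. As
  `τ ≤ 1`, the condition `inf P(uᵀX ≠ 0) > 1 - τ` excludes that `Xᵀβ = Xᵀβstar` almost surely, and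
  so `βstar` is the only minimizer of the risk (`risk_lt_risk`).
* In the direction `u` at infinity, the loss is asymptotically at least its limit along the ray
  through `u` on the event `Xᵀu ≠ 0`, and at least `0` elsewhere. The mean of this lower bound is
  at least `τ + L(βstar) - P(Xᵀu = 0) > L(βstar)` (`risk_lt_integral_rayLimit`).
* By dominated convergence and the strong law applied to infima of the loss over small sets, these
  strict inequalities at a single `β`, or in a single direction at infinity, carry over to empirical
  averages, uniformly on a neighbourhood (`exists_eventuallyAbove`). Compactness of bounded closed
  sets and of the unit sphere makes the bound uniform outside a ball around `βstar`
  (`induction_on_complement`, `eventuallyAbove_risk`).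
-/

namespace PenMT

/-! ### Bounded `ρ`-functions -/

namespace IsRhoFunction

variable {ρ : ℝ → ℝ}

lemma le_one (hB : IsRhoFunction ρ) (u : ℝ) : ρ u ≤ 1 := by
  have key : ∀ v, 0 ≤ v → ρ v ≤ 1 := fun v hv =>
    ge_of_tendsto hB.tendsto_one <| by
      filter_upwards [eventually_gt_atTop v] with w hw using hB.mono v w hv hw
  rcases le_total 0 u with hu | hu
  · exact key u hu
  · rw [hB.even]
    exact key (-u) (by linarith)

lemma tendsto_atBot (hB : IsRhoFunction ρ) : Tendsto ρ atBot (𝓝 1) := by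
  have h : ρ = fun u => ρ (-u) := funext hB.even
  rw [h]
  exact hB.tendsto_one.comp tendsto_neg_atBot_atTop

lemma uniformContinuous (hB : IsRhoFunction ρ) : UniformContinuous ρ := by
  refine hB.continuous.uniformContinuous_of_tendsto_cocompact (x := 1) ?_
  rw [cocompact_eq_atBot_atTop]
  exact hB.tendsto_atBot.sup hB.tendsto_one

lemma norm_le_one (hB : IsRhoFunction ρ) (u : ℝ) : ‖ρ u‖ ≤ 1 := by
  rw [Real.norm_of_nonneg (hB.nonneg u)]
  exact hB.le_one u

end IsRhoFunction

/-! ### Continuity of the location functional -/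

section Location

variable {ρ t : ℝ → ℝ} {s : ℝ}

/-- The expected loss is jointly continuous in the law of the response (for weak convergence) and
in the location, because `ρ` is bounded and uniformly continuous. -/
lemma tendsto_locLoss (hB : IsRhoFunction ρ) (ht : Continuous t) {ι : Type*} {l : Filter ι}
    {ν : ι → ProbabilityMeasure ℝ} {ν₀ : ProbabilityMeasure ℝ} (hν : Tendsto ν l (𝓝 ν₀))
    {γ : ι → ℝ} {γ₀ : ℝ} (hγ : Tendsto γ l (𝓝 γ₀)) :
    Tendsto (fun i => locLoss ρ t s (ν i) (γ i)) l (𝓝 (locLoss ρ t s ν₀ γ₀)) := by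
  have hcont : ∀ c, Continuous fun y => ρ ((t y - c) / √s) := fun c =>
    hB.continuous.comp ((ht.sub continuous_const).div_const _)
  have hint : ∀ i c, Integrable (fun y => ρ ((t y - c) / √s)) (ν i : Measure ℝ) := fun i c =>
    Integrable.of_bound (hcont c).aestronglyMeasurable 1 (ae_of_all _ fun _ => hB.norm_le_one _)
  have h1 : Tendsto (fun i => locLoss ρ t s (ν i) γ₀) l (𝓝 (locLoss ρ t s ν₀ γ₀)) :=
    ProbabilityMeasure.tendsto_iff_forall_integral_tendsto.1 hν
      (BoundedContinuousFunction.ofNormedAddCommGroup (fun y => ρ ((t y - γ₀) / √s)) (hcont γ₀) 1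
        fun _ => hB.norm_le_one _)
  have h2 : Tendsto (fun i => locLoss ρ t s (ν i) (γ i) - locLoss ρ t s (ν i) γ₀) l (𝓝 0) := by
    rw [Metric.tendsto_nhds]
    intro ε hε
    obtain ⟨δ, hδ, hρ⟩ := Metric.uniformContinuous_iff.1 hB.uniformContinuous (ε / 2) (by linarith)
    have h3 : Tendsto (fun i => (γ i - γ₀) / √s) l (𝓝 0) := by
      simpa using (hγ.sub_const γ₀).div_const (√s)
    filter_upwards [Metric.tendsto_nhds.1 h3 δ hδ] with i hi
    rw [dist_zero_right, locLoss, locLoss, ← integral_sub (hint i _) (hint i _)]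
    refine lt_of_le_of_lt (norm_integral_le_of_norm_le_const (C := ε / 2)
      (ae_of_all _ fun y => ?_)) (by simp; linarith)
    rw [← dist_eq_norm]
    refine (hρ ?_).le
    rw [dist_zero_right] at hi
    rw [dist_eq_norm, ← norm_neg]
    convert hi using 2
    ring
  simpa using h2.add h1

variable {F : ℝ → ProbabilityMeasure ℝ} {μ₁ μ₂ : EReal}

lemma MUniqueStrictMono.isMinOn (hA2 : MUniqueStrictMono ρ t s F μ₁ μ₂) {μ : ℝ}
    (hμ : μ ∈ meanRange μ₁ μ₂) : IsMinOn (locLoss ρ t s (F μ)) Set.univ (mFun ρ t s F μ) :=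
  Classical.epsilon_spec (hA2.1 μ hμ).exists

lemma MUniqueStrictMono.eq_mFun (hA2 : MUniqueStrictMono ρ t s F μ₁ μ₂) {μ γ : ℝ}
    (hμ : μ ∈ meanRange μ₁ μ₂) (hγ : ∀ c, locLoss ρ t s (F μ) γ ≤ locLoss ρ t s (F μ) c) :
    γ = mFun ρ t s F μ :=
  (hA2.1 μ hμ).unique (fun c _ => hγ c) (hA2.isMinOn hμ)

lemma isOpen_meanRange : IsOpen (meanRange μ₁ μ₂) :=
  (isOpen_Ioo (a := μ₁) (b := μ₂)).preimage continuous_coe_real_ereal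

/-- Near `μ` the values of `m` stay in a compact interval, by monotonicity, and each of their
cluster points minimizes the expected loss under `F μ`, hence equals `m μ`. -/
lemma MUniqueStrictMono.continuousAt_mFun (hA2 : MUniqueStrictMono ρ t s F μ₁ μ₂)
    (hB : IsRhoFunction ρ) (ht : Continuous t) (hF : ContinuousOn F (meanRange μ₁ μ₂)) {μ : ℝ}
    (hμ : μ ∈ meanRange μ₁ μ₂) : ContinuousAt (mFun ρ t s F) μ := by
  have hmem : meanRange μ₁ μ₂ ∈ 𝓝 μ := isOpen_meanRange.mem_nhds hμ
  obtain ⟨δ, hδ, hball⟩ := Metric.nhds_basis_closedBall.mem_iff.1 hmem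
  have hIcc : Metric.closedBall μ δ = Set.Icc (μ - δ) (μ + δ) := Real.closedBall_eq_Icc
  have ha : μ - δ ∈ meanRange μ₁ μ₂ := hball (by rw [hIcc]; constructor <;> linarith)
  have hb : μ + δ ∈ meanRange μ₁ μ₂ := hball (by rw [hIcc]; constructor <;> linarith)
  refine isCompact_Icc.tendsto_nhds_of_unique_mapClusterPt
    (s := Set.Icc (mFun ρ t s F (μ - δ)) (mFun ρ t s F (μ + δ))) ?_ ?_
  · filter_upwards [Metric.closedBall_mem_nhds μ hδ] with ν hν
    have hν' := hball hν
    rw [hIcc] at hν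
    exact ⟨hA2.2.monotoneOn ha hν' hν.1, hA2.2.monotoneOn hν' hb hν.2⟩
  · intro γ _ hγ
    obtain ⟨U, hU, hUγ⟩ := mapClusterPt_iff_ultrafilter.1 hγ
    have hFU : Tendsto F U (𝓝 (F μ)) := (hF.continuousAt hmem).mono_left hU
    refine hA2.eq_mFun hμ fun c => ?_
    refine le_of_tendsto_of_tendsto (tendsto_locLoss hB ht hFU hUγ)
      (tendsto_locLoss hB ht hFU tendsto_const_nhds) ?_
    filter_upwards [hU hmem] with ν hν using hA2.isMinOn hν (Set.mem_univ c)

end Location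

/-! ### The inverse link and the loss at a linear predictor -/

section Link

variable {μ₁ μ₂ : EReal} {g : ℝ → ℝ}

lemma IsLink.exists_le (hg : IsLink μ₁ μ₂ g) (c : ℝ) : ∃ μ ∈ meanRange μ₁ μ₂, g μ ≤ c := by
  have h := hg.tendsto_left.eventually (eventually_le_atBot c)
  obtain ⟨S, hS, hSg⟩ := mem_comap.1 h
  obtain ⟨b, hb, hbS⟩ := (mem_nhdsGT_iff_exists_Ioo_subset' hg.lt).1 hS
  obtain ⟨μ, hμ, hμb⟩ := EReal.lt_iff_exists_real_btwn.1 (lt_min hb hg.lt)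
  exact ⟨μ, ⟨hμ, hμb.trans_le (min_le_right _ _)⟩, hSg (hbS ⟨hμ, hμb.trans_le (min_le_left _ _)⟩)⟩

lemma IsLink.exists_ge (hg : IsLink μ₁ μ₂ g) (c : ℝ) : ∃ μ ∈ meanRange μ₁ μ₂, c ≤ g μ := by
  have h := hg.tendsto_right.eventually (eventually_ge_atTop c)
  obtain ⟨S, hS, hSg⟩ := mem_comap.1 h
  obtain ⟨b, hb, hbS⟩ := (mem_nhdsLT_iff_exists_Ioo_subset' hg.lt).1 hS
  obtain ⟨μ, hμb, hμ⟩ := EReal.lt_iff_exists_real_btwn.1 (max_lt hb hg.lt)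
  exact ⟨μ, ⟨(le_max_right _ _).trans_lt hμb, hμ⟩, hSg (hbS ⟨(le_max_left _ _).trans_lt hμb, hμ⟩)⟩

lemma ordConnected_meanRange : (meanRange μ₁ μ₂).OrdConnected :=
  ⟨fun _ hx _ hy _ hz => ⟨hx.1.trans_le (EReal.coe_le_coe_iff.2 hz.1),
    (EReal.coe_le_coe_iff.2 hz.2).trans_lt hy.2⟩⟩

lemma IsLink.surjOn (hg : IsLink μ₁ μ₂ g) : Set.SurjOn g (meanRange μ₁ μ₂) Set.univ := by
  intro c _
  obtain ⟨a, ha, hac⟩ := hg.exists_le c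
  obtain ⟨b, hb, hcb⟩ := hg.exists_ge c
  exact ordConnected_meanRange.isPreconnected.intermediate_value ha hb hg.continuousOn ⟨hac, hcb⟩

lemma IsLink.invLink_mem (hg : IsLink μ₁ μ₂ g) (η : ℝ) : invLink μ₁ μ₂ g η ∈ meanRange μ₁ μ₂ :=
  Function.invFunOn_mem (hg.surjOn (Set.mem_univ η))

lemma IsLink.apply_invLink (hg : IsLink μ₁ μ₂ g) (η : ℝ) : g (invLink μ₁ μ₂ g η) = η :=
  Function.invFunOn_eq (hg.surjOn (Set.mem_univ η))

lemma IsLink.strictMono_invLink (hg : IsLink μ₁ μ₂ g) : StrictMono (invLink μ₁ μ₂ g) := by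
  intro a b hab
  rw [← hg.strictMonoOn.lt_iff_lt (hg.invLink_mem a) (hg.invLink_mem b), hg.apply_invLink,
    hg.apply_invLink]
  exact hab

lemma IsLink.range_invLink (hg : IsLink μ₁ μ₂ g) :
    Set.range (invLink μ₁ μ₂ g) = meanRange μ₁ μ₂ := by
  refine (Set.range_subset_iff.2 hg.invLink_mem).antisymm fun μ hμ => ⟨g μ, ?_⟩
  exact hg.strictMonoOn.injOn (hg.invLink_mem _) hμ (hg.apply_invLink _)

lemma IsLink.continuous_invLink (hg : IsLink μ₁ μ₂ g) : Continuous (invLink μ₁ μ₂ g) := by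
  refine continuous_iff_continuousAt.2 fun η =>
    continuousAt_of_monotoneOn_of_image_mem_nhds (s := Set.univ)
      (hg.strictMono_invLink.monotone.monotoneOn _) univ_mem ?_
  rw [Set.image_univ, hg.range_invLink]
  exact isOpen_meanRange.mem_nhds (hg.invLink_mem η)

variable {ρ t : ℝ → ℝ} {s : ℝ} {F : ℝ → ProbabilityMeasure ℝ}

lemma MUniqueStrictMono.strictMono_mFun_invLink (hA2 : MUniqueStrictMono ρ t s F μ₁ μ₂)
    (hg : IsLink μ₁ μ₂ g) : StrictMono fun η => mFun ρ t s F (invLink μ₁ μ₂ g η) :=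
  fun _ _ hab => hA2.2 (hg.invLink_mem _) (hg.invLink_mem _) (hg.strictMono_invLink hab)

lemma MUniqueStrictMono.continuous_mFun_invLink (hA2 : MUniqueStrictMono ρ t s F μ₁ μ₂)
    (hg : IsLink μ₁ μ₂ g) (hB : IsRhoFunction ρ) (ht : Continuous t)
    (hF : ContinuousOn F (meanRange μ₁ μ₂)) :
    Continuous fun η => mFun ρ t s F (invLink μ₁ μ₂ g η) :=
  continuous_iff_continuousAt.2 fun η =>
    (hA2.continuousAt_mFun hB ht hF (hg.invLink_mem η)).comp' hg.continuous_invLink.continuousAt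

lemma continuous_mtLoss (hA2 : MUniqueStrictMono ρ t s F μ₁ μ₂)
    (hg : IsLink μ₁ μ₂ g) (hB : IsRhoFunction ρ) (ht : Continuous t)
    (hF : ContinuousOn F (meanRange μ₁ μ₂)) :
    Continuous fun z : ℝ × ℝ => mtLoss ρ t s F μ₁ μ₂ g z.1 z.2 :=
  hB.continuous.comp (((ht.comp continuous_fst).sub
    ((hA2.continuous_mFun_invLink hg hB ht hF).comp continuous_snd)).div_const _)

lemma exists_tendsto_mtLoss_atTop (hs : 0 < s) (hA2 : MUniqueStrictMono ρ t s F μ₁ μ₂)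
    (hg : IsLink μ₁ μ₂ g) (hB : IsRhoFunction ρ) (y : ℝ) :
    ∃ l, Tendsto (mtLoss ρ t s F μ₁ μ₂ g y) atTop (𝓝 l) := by
  have hs' : 0 < √s := Real.sqrt_pos.2 hs
  rcases tendsto_atTop_of_monotone (hA2.strictMono_mFun_invLink hg).monotone with h | ⟨l, h⟩
  · exact ⟨1, hB.tendsto_atBot.comp
      ((tendsto_atBot_add_const_left _ (t y) (tendsto_neg_atTop_atBot.comp h)).atBot_div_const hs')⟩
  · exact ⟨_, (hB.continuous.tendsto _).comp ((h.const_sub (t y)).div_const (√s))⟩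

lemma exists_tendsto_mtLoss_atBot (hs : 0 < s) (hA2 : MUniqueStrictMono ρ t s F μ₁ μ₂)
    (hg : IsLink μ₁ μ₂ g) (hB : IsRhoFunction ρ) (y : ℝ) :
    ∃ l, Tendsto (mtLoss ρ t s F μ₁ μ₂ g y) atBot (𝓝 l) := by
  have hs' : 0 < √s := Real.sqrt_pos.2 hs
  have hanti : Antitone fun η => mFun ρ t s F (invLink μ₁ μ₂ g (-η)) := fun a b hab =>
    (hA2.strictMono_mFun_invLink hg).monotone (neg_le_neg hab)
  suffices ∃ l, Tendsto (fun η => mtLoss ρ t s F μ₁ μ₂ g y (-η)) atTop (𝓝 l) by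
    obtain ⟨l, hl⟩ := this
    exact ⟨l, by simpa [Function.comp_def] using hl.comp tendsto_neg_atBot_atTop⟩
  rcases tendsto_atTop_of_antitone hanti with h | ⟨l, h⟩
  · exact ⟨1, hB.tendsto_one.comp
      ((tendsto_atTop_add_const_left _ (t y) (tendsto_neg_atBot_atTop.comp h)).atTop_div_const hs')⟩
  · exact ⟨_, (hB.continuous.tendsto _).comp ((h.const_sub (t y)).div_const (√s))⟩

end Link

/-! ### Uniform lower bounds for empirical averages -/

section Wald

variable {B 𝓩 : Type*} {ℓ : B → 𝓩 → ℝ}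

/-- The lower envelope `z ↦ inf_{β ∈ U} ℓ β z` of a family of loss functions. -/
noncomputable def lowerEnv (ℓ : B → 𝓩 → ℝ) (U : Set B) (z : 𝓩) : ℝ := ⨅ β : U, ℓ β z

lemma bddBelow_loss (h0 : ∀ β z, 0 ≤ ℓ β z) (U : Set B) (z : 𝓩) :
    BddBelow (Set.range fun β : U => ℓ β z) :=
  ⟨0, by rintro _ ⟨β, rfl⟩; exact h0 _ _⟩

lemma lowerEnv_le (h0 : ∀ β z, 0 ≤ ℓ β z) {U : Set B} {β : B} (hβ : β ∈ U) (z : 𝓩) :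
    lowerEnv ℓ U z ≤ ℓ β z :=
  ciInf_le (bddBelow_loss h0 U z) ⟨β, hβ⟩

lemma lowerEnv_nonneg (h0 : ∀ β z, 0 ≤ ℓ β z) (U : Set B) (z : 𝓩) : 0 ≤ lowerEnv ℓ U z :=
  Real.iInf_nonneg fun _ => h0 _ _

lemma norm_lowerEnv_le_one (h0 : ∀ β z, 0 ≤ ℓ β z) (h1 : ∀ β z, ℓ β z ≤ 1) (U : Set B) (z : 𝓩) :
    ‖lowerEnv ℓ U z‖ ≤ 1 := by
  rw [Real.norm_of_nonneg (lowerEnv_nonneg h0 U z)]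
  rcases U.eq_empty_or_nonempty with rfl | ⟨β, hβ⟩
  · simp [lowerEnv]
  · exact (lowerEnv_le h0 hβ z).trans (h1 _ _)

variable {Ω : Type*} [MeasurableSpace Ω] {P : Measure Ω} {Z : ℕ → Ω → 𝓩}

/-- The empirical averages of the losses in `A` exceed, uniformly over `A` and for all large
sample sizes, a constant larger than `c`, almost surely. -/
def EventuallyAbove (P : Measure Ω) (Z : ℕ → Ω → 𝓩) (ℓ : B → 𝓩 → ℝ) (c : ℝ) (A : Set B) : Prop :=
  ∃ c' > c, ∀ᵐ ω ∂P, ∀ᶠ n : ℕ in atTop, ∀ β ∈ A,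
    c' ≤ (1 / (n : ℝ)) * ∑ i ∈ Finset.range n, ℓ β (Z i ω)

namespace EventuallyAbove

variable {c : ℝ} {A A' : Set B}

lemma empty : EventuallyAbove P Z ℓ c ∅ :=
  ⟨c + 1, by linarith, by simp⟩

lemma mono (h : EventuallyAbove P Z ℓ c A') (hA : A ⊆ A') : EventuallyAbove P Z ℓ c A := by
  obtain ⟨c', hc', h⟩ := h
  refine ⟨c', hc', ?_⟩
  filter_upwards [h] with ω hω
  filter_upwards [hω] with n hn β hβ using hn β (hA hβ)

lemma union (h : EventuallyAbove P Z ℓ c A) (h' : EventuallyAbove P Z ℓ c A') :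
    EventuallyAbove P Z ℓ c (A ∪ A') := by
  obtain ⟨c₁, hc₁, h⟩ := h
  obtain ⟨c₂, hc₂, h'⟩ := h'
  refine ⟨min c₁ c₂, lt_min hc₁ hc₂, ?_⟩
  filter_upwards [h, h'] with ω hω hω'
  filter_upwards [hω, hω'] with n hn hn' β hβ
  rcases hβ with hβ | hβ
  · exact (min_le_left _ _).trans (hn β hβ)
  · exact (min_le_right _ _).trans (hn' β hβ)

end EventuallyAbove

variable [TopologicalSpace B] [SecondCountableTopology B] [MeasurableSpace 𝓩]

/-- The infimum may be taken over a countable dense subset of `U`. -/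
lemma measurable_lowerEnv (h0 : ∀ β z, 0 ≤ ℓ β z) (hc : ∀ z, Continuous fun β => ℓ β z)
    (hm : ∀ β, Measurable (ℓ β)) (U : Set B) : Measurable (lowerEnv ℓ U) := by
  rcases U.eq_empty_or_nonempty with rfl | hU
  · have : lowerEnv ℓ (∅ : Set B) = fun _ => 0 := by ext z; simp [lowerEnv]
    rw [this]
    exact measurable_const
  have : Nonempty U := hU.to_subtype
  have key : lowerEnv ℓ U = fun z => ⨅ n, ℓ (TopologicalSpace.denseSeq U n) z := by
    ext z
    refine le_antisymm (le_ciInf fun n => ciInf_le (bddBelow_loss h0 U z) _) (le_ciInf fun β => ?_)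
    have hcl : IsClosed {β : U | ⨅ n, ℓ (TopologicalSpace.denseSeq U n) z ≤ ℓ β z} :=
      isClosed_le continuous_const ((hc z).comp continuous_subtype_val)
    refine (TopologicalSpace.denseRange_denseSeq U).induction_on β hcl fun n => ?_
    exact ciInf_le (f := fun n => ℓ (TopologicalSpace.denseSeq U n) z)
      ⟨0, by rintro _ ⟨n, rfl⟩; exact h0 _ _⟩ n
  rw [key]
  exact Measurable.iInf fun n => hm _

variable {Z₀ : Ω → 𝓩}

lemma tendsto_average (hindep : iIndepFun Z P) (hident : ∀ i, IdentDistrib (Z i) Z₀ P P)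
    {q : 𝓩 → ℝ} (hq : Measurable q) (hint : Integrable (fun ω => q (Z₀ ω)) P) :
    ∀ᵐ ω ∂P, Tendsto (fun n : ℕ => (1 / (n : ℝ)) * ∑ i ∈ Finset.range n, q (Z i ω)) atTop
      (𝓝 (∫ ω, q (Z₀ ω) ∂P)) := by
  have hid : ∀ i, IdentDistrib (fun ω => q (Z i ω)) (fun ω => q (Z₀ ω)) P P := fun i =>
    (hident i).comp hq
  have h := strong_law_ae_real (fun i ω => q (Z i ω)) ((hid 0).integrable_iff.2 hint)
    (fun i j hij => (hindep.indepFun hij).comp hq hq) (fun i => (hid i).trans (hid 0).symm)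
  filter_upwards [h] with ω hω
  rw [← (hid 0).integral_eq]
  refine hω.congr fun n => ?_
  rw [one_div, div_eq_inv_mul]

variable [IsProbabilityMeasure P]

lemma eventuallyAbove_of_lt_integral (h0 : ∀ β z, 0 ≤ ℓ β z) (h1 : ∀ β z, ℓ β z ≤ 1)
    (hc : ∀ z, Continuous fun β => ℓ β z) (hm : ∀ β, Measurable (ℓ β))
    (hZ₀ : Measurable Z₀) (hindep : iIndepFun Z P) (hident : ∀ i, IdentDistrib (Z i) Z₀ P P)
    {c : ℝ} {U : Set B} (hU : c < ∫ ω, lowerEnv ℓ U (Z₀ ω) ∂P) :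
    EventuallyAbove P Z ℓ c U := by
  have hmeas := measurable_lowerEnv h0 hc hm U
  obtain ⟨c', hc', hc'U⟩ := exists_between hU
  refine ⟨c', hc', ?_⟩
  filter_upwards [tendsto_average hindep hident hmeas (Integrable.of_bound
    (hmeas.comp hZ₀).aestronglyMeasurable 1
    (ae_of_all _ fun ω => norm_lowerEnv_le_one h0 h1 U _))] with ω hω
  filter_upwards [hω.eventually_const_lt hc'U] with n hn β hβ
  refine hn.le.trans (mul_le_mul_of_nonneg_left (Finset.sum_le_sum fun i _ => ?_) (by positivity))
  exact lowerEnv_le h0 hβ _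

/-- If the infima of the loss over `U k` have a pointwise lower limit at least `r`, then the
empirical averages over some `U k` stay above any constant smaller than the mean of `r`: the
mean of the minimum of `r` and the infimum over `U k` tends to the mean of `r`. -/
lemma exists_eventuallyAbove (h0 : ∀ β z, 0 ≤ ℓ β z) (h1 : ∀ β z, ℓ β z ≤ 1)
    (hc : ∀ z, Continuous fun β => ℓ β z) (hm : ∀ β, Measurable (ℓ β))
    (hZ₀ : Measurable Z₀) (hindep : iIndepFun Z P) (hident : ∀ i, IdentDistrib (Z i) Z₀ P P)
    {c : ℝ} {U : ℕ → Set B} {r : 𝓩 → ℝ} (hr : Measurable r) (hr0 : ∀ z, 0 ≤ r z)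
    (hr1 : ∀ z, r z ≤ 1) (hU : ∀ z, ∀ ε > 0, ∀ᶠ k in atTop, ∀ β ∈ U k, r z - ε ≤ ℓ β z)
    (hcr : c < ∫ ω, r (Z₀ ω) ∂P) : ∃ k, EventuallyAbove P Z ℓ c (U k) := by
  by_cases hne : ∃ k, U k = ∅
  · obtain ⟨k, hk⟩ := hne
    exact ⟨k, hk ▸ EventuallyAbove.empty⟩
  have hne' : ∀ k, (U k).Nonempty := fun k =>
    Set.nonempty_iff_ne_empty.2 fun h => hne ⟨k, h⟩
  have hmeas := fun k => measurable_lowerEnv h0 hc hm (U k)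
  have hlim : Tendsto (fun k => ∫ ω, min (r (Z₀ ω)) (lowerEnv ℓ (U k) (Z₀ ω)) ∂P) atTop
      (𝓝 (∫ ω, r (Z₀ ω) ∂P)) := by
    refine tendsto_integral_of_dominated_convergence (fun _ => 1)
      (fun k => ((hr.min (hmeas k)).comp hZ₀).aestronglyMeasurable) (integrable_const _)
      (fun k => ae_of_all _ fun ω => ?_) (ae_of_all _ fun ω => ?_)
    · rw [Real.norm_of_nonneg (le_min (hr0 _) (lowerEnv_nonneg h0 _ _))]
      exact (min_le_left _ _).trans (hr1 _)
    · rw [Metric.tendsto_nhds]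
      intro ε hε
      filter_upwards [hU (Z₀ ω) (ε / 2) (by linarith)] with k hk
      have : Nonempty (U k) := (hne' k).to_subtype
      have h2 : r (Z₀ ω) - ε / 2 ≤ min (r (Z₀ ω)) (lowerEnv ℓ (U k) (Z₀ ω)) :=
        le_min (by linarith) (le_ciInf fun β => hk β β.2)
      have h3 := min_le_left (r (Z₀ ω)) (lowerEnv ℓ (U k) (Z₀ ω))
      rw [Real.dist_eq, abs_lt]
      constructor <;> linarith
  obtain ⟨k, hk⟩ := (hlim.eventually_const_lt hcr).exists
  refine ⟨k, eventuallyAbove_of_lt_integral h0 h1 hc hm hZ₀ hindep hident (hk.trans_le ?_)⟩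
  refine integral_mono
    (Integrable.of_bound ((hr.min (hmeas k)).comp hZ₀).aestronglyMeasurable 1
      (ae_of_all _ fun ω => ?_))
    (Integrable.of_bound ((hmeas k).comp hZ₀).aestronglyMeasurable 1
      (ae_of_all _ fun ω => norm_lowerEnv_le_one h0 h1 _ _)) fun ω => min_le_right _ _
  rw [Real.norm_of_nonneg (le_min (hr0 _) (lowerEnv_nonneg h0 _ _))]
  exact (min_le_left _ _).trans (hr1 _)

end Wald

/-! ### Directions at infinity and compactness -/

section Linear

variable {E : Type*} [NormedAddCommGroup E] [InnerProductSpace ℝ E]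

/-- The truncated cone of the vectors longer than `k` whose direction is at distance less than
`1 / (k + 1)` from `u`. These sets are the neighbourhoods of the point at infinity in
direction `u`. -/
def farCone (u : E) (k : ℕ) : Set E :=
  {β | (k : ℝ) < ‖β‖ ∧ ‖β - ‖β‖ • u‖ < ‖β‖ * (1 / ((k : ℝ) + 1))}

lemma eventually_le_inner_farCone {u w : E} (hw : 0 < inner ℝ w u) (N : ℝ) :
    ∀ᶠ k : ℕ in atTop, ∀ β ∈ farCone u k, N ≤ inner ℝ w β := by
  set d : ℝ := inner ℝ w u with hd
  have h1 : Tendsto (fun k : ℕ => ‖w‖ * (1 / ((k : ℝ) + 1))) atTop (𝓝 0) := by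
    simpa using (tendsto_one_div_add_atTop_nhds_zero_nat (𝕜 := ℝ)).const_mul ‖w‖
  have h2 : Tendsto (fun k : ℕ => (k : ℝ) * (d / 2)) atTop atTop :=
    tendsto_natCast_atTop_atTop.atTop_mul_const (by linarith)
  filter_upwards [h1.eventually_lt_const (show (0 : ℝ) < d / 2 by linarith),
    h2.eventually_ge_atTop N] with k hk hN β hβ
  have h3 : inner ℝ w β = ‖β‖ * d + inner ℝ w (β - ‖β‖ • u) := by
    rw [inner_sub_right, inner_smul_right]
    ring
  have h4 : -(‖w‖ * ‖β - ‖β‖ • u‖) ≤ inner ℝ w (β - ‖β‖ • u) :=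
    (abs_le.1 (abs_real_inner_le_norm _ _)).1
  have h5 : ‖w‖ * ‖β - ‖β‖ • u‖ ≤ ‖β‖ * (d / 2) := by
    calc ‖w‖ * ‖β - ‖β‖ • u‖ ≤ ‖w‖ * (‖β‖ * (1 / ((k : ℝ) + 1))) := by gcongr; exact hβ.2.le
      _ = ‖β‖ * (‖w‖ * (1 / ((k : ℝ) + 1))) := by ring
      _ ≤ _ := by gcongr
  have h6 : (k : ℝ) * (d / 2) ≤ ‖β‖ * (d / 2) := by
    have := hβ.1.le
    gcongr
  linarith

lemma eventually_inner_farCone_le {u w : E} (hw : inner ℝ w u < 0) (N : ℝ) :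
    ∀ᶠ k : ℕ in atTop, ∀ β ∈ farCone u k, inner ℝ w β ≤ N := by
  filter_upwards [eventually_le_inner_farCone (u := u) (w := -w) (by simpa using hw) (-N)] with k hk β hβ
  have := hk β hβ
  rw [inner_neg_left] at this
  linarith

/-- A property of sets that is stable under subsets and finite unions, holds near each point
of `{β | ε ≤ ‖β - β₀‖}` and near infinity in each direction, holds on `{β | ε ≤ ‖β - β₀‖}`:
compactness of bounded closed sets and of the unit sphere. -/
lemma induction_on_complement [FiniteDimensional ℝ E] {p : Set E → Prop} (hempty : p ∅)
    (hmono : ∀ ⦃A A'⦄, A ⊆ A' → p A' → p A) (hunion : ∀ ⦃A A'⦄, p A → p A' → p (A ∪ A'))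
    {β₀ : E} {ε : ℝ} (hloc : ∀ β, ε ≤ ‖β - β₀‖ → ∃ k : ℕ, p (Metric.ball β (1 / ((k : ℝ) + 1))))
    (hfar : ∀ u : E, ‖u‖ = 1 → ∃ k, p (farCone u k)) : p {β | ε ≤ ‖β - β₀‖} := by
  have : ProperSpace E := FiniteDimensional.proper_real E
  have hinf : ∃ k : ℕ, p {β | (k : ℝ) < ‖β‖ ∧ ‖β‖⁻¹ • β ∈ Metric.sphere (0 : E) 1} := by
    refine (isCompact_sphere (0 : E) 1).induction_on
      (p := fun S => ∃ k : ℕ, p {β | (k : ℝ) < ‖β‖ ∧ ‖β‖⁻¹ • β ∈ S}) ⟨0, by simpa using hempty⟩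
      ?_ ?_ ?_
    · rintro S S' hS ⟨k, hk⟩
      refine ⟨k, hmono ?_ hk⟩
      exact fun β hβ => ⟨hβ.1, hS hβ.2⟩
    · rintro S S' ⟨k, hk⟩ ⟨k', hk'⟩
      refine ⟨max k k', hmono ?_ (hunion hk hk')⟩
      rintro β ⟨hβ, hS⟩
      rw [Nat.cast_max] at hβ
      exact hS.imp (fun h => ⟨(le_max_left _ _).trans_lt hβ, h⟩)
        fun h => ⟨(le_max_right _ _).trans_lt hβ, h⟩
    · intro u hu
      obtain ⟨k, hk⟩ := hfar u (by simpa using hu)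
      refine ⟨Metric.ball u (1 / ((k : ℝ) + 1)),
        mem_nhdsWithin_of_mem_nhds (Metric.ball_mem_nhds _ (by positivity)), k, hmono ?_ hk⟩
      rintro β ⟨hβ, hS⟩
      have hpos : 0 < ‖β‖ := (Nat.cast_nonneg k).trans_lt hβ
      refine ⟨hβ, ?_⟩
      have heq : β - ‖β‖ • u = ‖β‖ • (‖β‖⁻¹ • β - u) := by
        rw [smul_sub, smul_inv_smul₀ hpos.ne']
      rw [heq, norm_smul, norm_norm]
      rw [Metric.mem_ball, dist_eq_norm] at hS
      gcongr
  obtain ⟨k, hk⟩ := hinf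
  have hcomp : IsCompact (Metric.closedBall (0 : E) k ∩ {β | ε ≤ ‖β - β₀‖}) :=
    (isCompact_closedBall _ _).inter_right
      (isClosed_le continuous_const (continuous_id.sub continuous_const).norm)
  have hbd : p (Metric.closedBall (0 : E) k ∩ {β | ε ≤ ‖β - β₀‖}) := by
    refine hcomp.induction_on hempty hmono hunion fun β hβ => ?_
    obtain ⟨j, hj⟩ := hloc β hβ.2
    exact ⟨_, mem_nhdsWithin_of_mem_nhds (Metric.ball_mem_nhds _ (by positivity)), hj⟩
  refine hmono (fun β hβ => ?_) (hunion hk hbd)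
  rcases lt_or_ge (k : ℝ) ‖β‖ with h | h
  · have hpos : 0 < ‖β‖ := (Nat.cast_nonneg k).trans_lt h
    refine Or.inl ?_
    exact ⟨h, by simp [norm_smul, hpos.ne']⟩
  · exact Or.inr ⟨by simpa using h, hβ⟩

end Linear

section Regression

variable {Ω : Type*} [MeasurableSpace Ω] {P : Measure Ω} {p : ℕ}
  {μ₁ μ₂ : EReal} {F : ℝ → ProbabilityMeasure ℝ} {s : ℝ} {g t ρ : ℝ → ℝ}
  {βstar : EuclideanSpace ℝ (Fin (p + 1))} {Y : Ω → ℝ} {X : Ω → EuclideanSpace ℝ (Fin (p + 1))}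

/-! ### Identification of the true parameter -/

lemma measurable_mtLoss_inner (hA2 : MUniqueStrictMono ρ t s F μ₁ μ₂)
    (hg : IsLink μ₁ μ₂ g) (hB : IsRhoFunction ρ) (ht : Continuous t)
    (hF : ContinuousOn F (meanRange μ₁ μ₂)) (β : EuclideanSpace ℝ (Fin (p + 1))) :
    Measurable fun z : ℝ × EuclideanSpace ℝ (Fin (p + 1)) =>
      mtLoss ρ t s F μ₁ μ₂ g z.1 (inner ℝ z.2 β) :=
  ((continuous_mtLoss hA2 hg hB ht hF).comp
    (continuous_fst.prodMk (continuous_snd.inner continuous_const))).measurable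

/-- Disintegration of the risk: given the covariates `w`, the response has law
`F (g⁻¹(wᵀβstar))`. The integrability makes the identity usable for comparing risks. -/
lemma risk_eq_integral_locLoss [IsProbabilityMeasure P] (hA2 : MUniqueStrictMono ρ t s F μ₁ μ₂)
    (hg : IsLink μ₁ μ₂ g) (hB : IsRhoFunction ρ) (ht : Continuous t)
    (hF : ContinuousOn F (meanRange μ₁ μ₂)) (hY : Measurable Y) (hX : Measurable X)
    (hGLM : FollowsGLM P Y X F μ₁ μ₂ g βstar) (β : EuclideanSpace ℝ (Fin (p + 1))) :
    Integrable (fun w => locLoss ρ t s (F (invLink μ₁ μ₂ g (inner ℝ w βstar)))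
        (mFun ρ t s F (invLink μ₁ μ₂ g (inner ℝ w β)))) (P.map X) ∧
      risk ρ t s F μ₁ μ₂ g P Y X β =
        ∫ w, locLoss ρ t s (F (invLink μ₁ μ₂ g (inner ℝ w βstar)))
          (mFun ρ t s F (invLink μ₁ μ₂ g (inner ℝ w β))) ∂(P.map X) := by
  have : IsProbabilityMeasure (P.map X) := Measure.isProbabilityMeasure_map hX.aemeasurable
  set f : EuclideanSpace ℝ (Fin (p + 1)) × ℝ → ℝ := fun z =>
    mtLoss ρ t s F μ₁ μ₂ g z.2 (inner ℝ z.1 β) with hf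
  have hfm : Measurable f := (measurable_mtLoss_inner hA2 hg hB ht hF β).comp measurable_swap
  have hint : Integrable f ((P.map X) ⊗ₘ condDistrib Y X P) :=
    Integrable.of_bound hfm.aestronglyMeasurable 1 (ae_of_all _ fun _ => hB.norm_le_one _)
  have hae : (fun w => ∫ y, f (w, y) ∂(condDistrib Y X P w)) =ᵐ[P.map X]
      fun w => locLoss ρ t s (F (invLink μ₁ μ₂ g (inner ℝ w βstar)))
        (mFun ρ t s F (invLink μ₁ μ₂ g (inner ℝ w β))) := by
    filter_upwards [hGLM] with w hw
    rw [hw]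
    rfl
  refine ⟨(Integrable.integral_compProd hint).congr hae, ?_⟩
  rw [← integral_congr_ae hae, ← Measure.integral_compProd hint,
    compProd_map_condDistrib hY.aemeasurable,
    integral_map (hX.prodMk hY).aemeasurable hfm.aestronglyMeasurable]
  rfl

/-- Fisher consistency: the true parameter is the only minimizer of the risk, as long as the
covariates are not concentrated on a hyperplane. Given the covariates, `m(g⁻¹(Xᵀβ))` minimizes the
conditional expected loss only if it equals `m(g⁻¹(Xᵀβstar))`, that is if `Xᵀβ = Xᵀβstar`. -/
lemma risk_lt_risk [IsProbabilityMeasure P] (hA2 : MUniqueStrictMono ρ t s F μ₁ μ₂)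
    (hg : IsLink μ₁ μ₂ g) (hB : IsRhoFunction ρ) (ht : Continuous t)
    (hF : ContinuousOn F (meanRange μ₁ μ₂)) (hY : Measurable Y) (hX : Measurable X)
    (hGLM : FollowsGLM P Y X F μ₁ μ₂ g βstar) {β : EuclideanSpace ℝ (Fin (p + 1))}
    (hβ : 0 < P.real {ω | inner ℝ (X ω) (β - βstar) ≠ 0}) :
    risk ρ t s F μ₁ μ₂ g P Y X βstar < risk ρ t s F μ₁ μ₂ g P Y X β := by
  obtain ⟨hi, hr⟩ := risk_eq_integral_locLoss hA2 hg hB ht hF hY hX hGLM β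
  obtain ⟨hi', hr'⟩ := risk_eq_integral_locLoss hA2 hg hB ht hF hY hX hGLM βstar
  have hle : ∀ w : EuclideanSpace ℝ (Fin (p + 1)), ∀ c,
      locLoss ρ t s (F (invLink μ₁ μ₂ g (inner ℝ w βstar)))
        (mFun ρ t s F (invLink μ₁ μ₂ g (inner ℝ w βstar))) ≤
      locLoss ρ t s (F (invLink μ₁ μ₂ g (inner ℝ w βstar))) c := fun w c =>
    hA2.isMinOn (hg.invLink_mem _) (Set.mem_univ c)
  rw [hr, hr']
  refine lt_of_le_of_ne (integral_mono hi' hi fun w => hle w _) fun heq => hβ.ne' ?_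
  have hzero := (integral_eq_iff_of_ae_le hi' hi (ae_of_all _ fun w => hle w _)).1 heq
  have h := ae_of_ae_map hX.aemeasurable hzero
  rw [measureReal_def, (?_ : P {ω | inner ℝ (X ω) (β - βstar) ≠ 0} = 0), ENNReal.toReal_zero]
  refine (ae_iff (p := fun ω => inner ℝ (X ω) (β - βstar) = 0)).1 ?_
  filter_upwards [h] with ω hω
  rw [inner_sub_right, sub_eq_zero]
  refine (hA2.strictMono_mFun_invLink hg).injective
    (hA2.eq_mFun (hg.invLink_mem _) fun c => ?_)
  exact hω.symm.le.trans (hle _ c)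

/-! ### Behaviour of the loss at infinity -/

/-- The limit of the loss along the ray in direction `u`, set to zero where the linear predictor
`Xᵀu` vanishes. -/
noncomputable def rayLimit (ρ t : ℝ → ℝ) (s : ℝ) (F : ℝ → ProbabilityMeasure ℝ) (μ₁ μ₂ : EReal)
    (g : ℝ → ℝ) (u : EuclideanSpace ℝ (Fin (p + 1)))
    (z : ℝ × EuclideanSpace ℝ (Fin (p + 1))) : ℝ :=
  {z : ℝ × EuclideanSpace ℝ (Fin (p + 1)) | inner ℝ z.2 u ≠ 0}.indicator
    (fun z => limUnder atTop fun ζ : ℝ => mtLoss ρ t s F μ₁ μ₂ g z.1 (ζ * inner ℝ z.2 u)) z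

lemma tendsto_limUnder_ray (hs : 0 < s) (hA2 : MUniqueStrictMono ρ t s F μ₁ μ₂)
    (hg : IsLink μ₁ μ₂ g) (hB : IsRhoFunction ρ) (y c : ℝ) :
    Tendsto (fun ζ : ℝ => mtLoss ρ t s F μ₁ μ₂ g y (ζ * c)) atTop
      (𝓝 (limUnder atTop fun ζ : ℝ => mtLoss ρ t s F μ₁ μ₂ g y (ζ * c))) := by
  refine tendsto_nhds_limUnder ?_
  rcases lt_trichotomy c 0 with hc | rfl | hc
  · obtain ⟨l, hl⟩ := exists_tendsto_mtLoss_atBot hs hA2 hg hB y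
    exact ⟨l, hl.comp (tendsto_id.atTop_mul_const_of_neg hc)⟩
  · exact ⟨mtLoss ρ t s F μ₁ μ₂ g y 0, by simp⟩
  · obtain ⟨l, hl⟩ := exists_tendsto_mtLoss_atTop hs hA2 hg hB y
    exact ⟨l, hl.comp (tendsto_id.atTop_mul_const hc)⟩

lemma limUnder_ray_mem_Icc (hs : 0 < s) (hA2 : MUniqueStrictMono ρ t s F μ₁ μ₂)
    (hg : IsLink μ₁ μ₂ g) (hB : IsRhoFunction ρ) (y c : ℝ) :
    (limUnder atTop fun ζ : ℝ => mtLoss ρ t s F μ₁ μ₂ g y (ζ * c)) ∈ Set.Icc 0 1 :=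
  isClosed_Icc.mem_of_tendsto (tendsto_limUnder_ray hs hA2 hg hB y c)
    (Eventually.of_forall fun _ => ⟨hB.nonneg _, hB.le_one _⟩)

lemma measurable_limUnder_ray (hs : 0 < s) (hA2 : MUniqueStrictMono ρ t s F μ₁ μ₂)
    (hg : IsLink μ₁ μ₂ g) (hB : IsRhoFunction ρ) (ht : Continuous t)
    (hF : ContinuousOn F (meanRange μ₁ μ₂)) (u : EuclideanSpace ℝ (Fin (p + 1))) :
    Measurable fun z : ℝ × EuclideanSpace ℝ (Fin (p + 1)) =>
      limUnder atTop fun ζ : ℝ => mtLoss ρ t s F μ₁ μ₂ g z.1 (ζ * inner ℝ z.2 u) := by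
  refine measurable_of_tendsto_metrizable
    (f := fun (n : ℕ) z => mtLoss ρ t s F μ₁ μ₂ g z.1 (n * inner ℝ z.2 u)) (fun n => ?_) ?_
  · simp_rw [← inner_smul_right]
    exact measurable_mtLoss_inner hA2 hg hB ht hF _
  · exact tendsto_pi_nhds.2 fun z =>
      (tendsto_limUnder_ray hs hA2 hg hB z.1 _).comp tendsto_natCast_atTop_atTop

lemma measurableSet_inner_ne_zero (u : EuclideanSpace ℝ (Fin (p + 1))) :
    MeasurableSet {z : ℝ × EuclideanSpace ℝ (Fin (p + 1)) | inner ℝ z.2 u ≠ 0} :=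
  ((continuous_snd.inner continuous_const).measurable (measurableSet_singleton (0 : ℝ))).compl

lemma rayLimit_mem_Icc (hs : 0 < s) (hA2 : MUniqueStrictMono ρ t s F μ₁ μ₂)
    (hg : IsLink μ₁ μ₂ g) (hB : IsRhoFunction ρ) (u : EuclideanSpace ℝ (Fin (p + 1)))
    (z : ℝ × EuclideanSpace ℝ (Fin (p + 1))) :
    rayLimit ρ t s F μ₁ μ₂ g u z ∈ Set.Icc 0 1 := by
  rw [rayLimit, Set.indicator_apply]
  split_ifs
  · exact limUnder_ray_mem_Icc hs hA2 hg hB _ _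
  · exact ⟨le_rfl, zero_le_one⟩

/-- Along `farCone u k` the loss is asymptotically at least `rayLimit`. If `Xᵀu ≠ 0`, then `Xᵀβ`
tends to infinity with the sign of `Xᵀu`, uniformly over `β` in the cone; if `Xᵀu = 0`, the sign
of `Xᵀβ` is not controlled, and only the nonnegativity of the loss is used. -/
lemma rayLimit_sub_le (hs : 0 < s) (hA2 : MUniqueStrictMono ρ t s F μ₁ μ₂)
    (hg : IsLink μ₁ μ₂ g) (hB : IsRhoFunction ρ) (u : EuclideanSpace ℝ (Fin (p + 1)))
    (z : ℝ × EuclideanSpace ℝ (Fin (p + 1))) {ε : ℝ} (hε : 0 < ε) :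
    ∀ᶠ k in atTop, ∀ β ∈ farCone u k,
      rayLimit ρ t s F μ₁ μ₂ g u z - ε ≤ mtLoss ρ t s F μ₁ μ₂ g z.1 (inner ℝ z.2 β) := by
  obtain ⟨y, w⟩ := z
  rcases lt_trichotomy (inner ℝ w u) 0 with hc | hc | hc
  · obtain ⟨l, hl⟩ := exists_tendsto_mtLoss_atBot hs hA2 hg hB y
    have hray : rayLimit ρ t s F μ₁ μ₂ g u (y, w) = l := by
      rw [rayLimit, Set.indicator_of_mem (show (y, w) ∈ {z : ℝ × _ | inner ℝ z.2 u ≠ 0} from hc.ne)]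
      exact (hl.comp (tendsto_id.atTop_mul_const_of_neg hc)).limUnder_eq
    obtain ⟨N, hN⟩ := eventually_atBot.1 (hl.eventually_const_le (show l - ε < l by linarith))
    filter_upwards [eventually_inner_farCone_le hc N] with k hk β hβ
    rw [hray]
    exact hN _ (hk β hβ)
  · refine Eventually.of_forall fun k β _ => ?_
    have hray : rayLimit ρ t s F μ₁ μ₂ g u (y, w) = 0 :=
      Set.indicator_of_notMem (by simpa using hc) _
    rw [hray]
    exact le_trans (by linarith) (hB.nonneg _)
  · obtain ⟨l, hl⟩ := exists_tendsto_mtLoss_atTop hs hA2 hg hB y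
    have hray : rayLimit ρ t s F μ₁ μ₂ g u (y, w) = l := by
      rw [rayLimit, Set.indicator_of_mem
        (show (y, w) ∈ {z : ℝ × _ | inner ℝ z.2 u ≠ 0} from hc.ne')]
      exact (hl.comp (tendsto_id.atTop_mul_const hc)).limUnder_eq
    obtain ⟨N, hN⟩ := eventually_atTop.1 (hl.eventually_const_le (show l - ε < l by linarith))
    filter_upwards [eventually_le_inner_farCone hc N] with k hk β hβ
    rw [hray]
    exact hN _ (hk β hβ)

lemma bddBelow_range_prob :
    BddBelow (Set.range fun u : Metric.sphere (0 : EuclideanSpace ℝ (Fin (p + 1))) 1 =>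
      P.real {ω | inner ℝ (X ω) u.1 ≠ 0}) :=
  ⟨0, by rintro _ ⟨u, rfl⟩; exact measureReal_nonneg⟩

lemma tau_add_risk_le (hs : 0 < s) (hA2 : MUniqueStrictMono ρ t s F μ₁ μ₂)
    (hg : IsLink μ₁ μ₂ g) (hB : IsRhoFunction ρ) {u : EuclideanSpace ℝ (Fin (p + 1))}
    (hu : ‖u‖ = 1) :
    tau ρ t s F μ₁ μ₂ g P Y X βstar + risk ρ t s F μ₁ μ₂ g P Y X βstar ≤
      ∫ ω, limUnder atTop
        (fun ζ : ℝ => mtLoss ρ t s F μ₁ μ₂ g (Y ω) (ζ * inner ℝ (X ω) u)) ∂P := by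
  rw [tau, sub_add_cancel]
  refine ciInf_le (ι := Metric.sphere (0 : EuclideanSpace ℝ (Fin (p + 1))) 1)
    (f := fun u => ∫ ω, limUnder atTop
        (fun ζ : ℝ => mtLoss ρ t s F μ₁ μ₂ g (Y ω) (ζ * inner ℝ (X ω) u.1)) ∂P)
    ⟨0, ?_⟩ ⟨u, by simpa using hu⟩
  rintro _ ⟨v, rfl⟩
  exact integral_nonneg fun ω => (limUnder_ray_mem_Icc hs hA2 hg hB _ _).1

/-- The covariates are not concentrated on a hyperplane, because `τ ≤ 1`. -/
lemma prob_inner_ne_zero_pos [IsProbabilityMeasure P] (hs : 0 < s)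
    (hA2 : MUniqueStrictMono ρ t s F μ₁ μ₂)
    (hg : IsLink μ₁ μ₂ g) (hB : IsRhoFunction ρ)
    (hB8 : 1 - tau ρ t s F μ₁ μ₂ g P Y X βstar < infNonzeroProb P X)
    {v : EuclideanSpace ℝ (Fin (p + 1))} (hv : v ≠ 0) :
    0 < P.real {ω | inner ℝ (X ω) v ≠ 0} := by
  have hv' : ‖v‖ ≠ 0 := norm_ne_zero_iff.2 hv
  have hu : ‖‖v‖⁻¹ • v‖ = 1 := norm_smul_inv_norm hv
  have h1 := tau_add_risk_le (P := P) (Y := Y) (X := X) (βstar := βstar) hs hA2 hg hB hu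
  have h2 : ∫ ω, limUnder atTop (fun ζ : ℝ =>
      mtLoss ρ t s F μ₁ μ₂ g (Y ω) (ζ * inner ℝ (X ω) (‖v‖⁻¹ • v))) ∂P ≤ 1 := by
    refine (integral_mono_of_nonneg
      (ae_of_all _ fun ω => (limUnder_ray_mem_Icc hs hA2 hg hB _ _).1)
      (integrable_const 1)
      (ae_of_all _ fun ω => (limUnder_ray_mem_Icc hs hA2 hg hB _ _).2)).trans ?_
    simp
  have h3 : 0 ≤ risk ρ t s F μ₁ μ₂ g P Y X βstar := integral_nonneg fun ω => hB.nonneg _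
  have h4 : infNonzeroProb P X ≤ P.real {ω | inner ℝ (X ω) (‖v‖⁻¹ • v) ≠ 0} :=
    ciInf_le bddBelow_range_prob
      (⟨‖v‖⁻¹ • v, by simpa using hu⟩ : Metric.sphere (0 : EuclideanSpace ℝ (Fin (p + 1))) 1)
  have h5 : {ω | inner ℝ (X ω) (‖v‖⁻¹ • v) ≠ 0} = {ω | inner ℝ (X ω) v ≠ 0} := by
    ext ω
    simp [inner_smul_right, hv]
  rw [h5] at h4
  linarith

/-- At infinity, in every direction, the mean of the loss stays above the risk of the true
parameter: replacing the limit loss by zero where `Xᵀu = 0` costs at most `P (Xᵀu = 0)`. -/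
lemma risk_lt_integral_rayLimit [IsProbabilityMeasure P] (hs : 0 < s)
    (hA2 : MUniqueStrictMono ρ t s F μ₁ μ₂)
    (hg : IsLink μ₁ μ₂ g) (hB : IsRhoFunction ρ) (ht : Continuous t)
    (hF : ContinuousOn F (meanRange μ₁ μ₂)) (hY : Measurable Y) (hX : Measurable X)
    (hB8 : 1 - tau ρ t s F μ₁ μ₂ g P Y X βstar < infNonzeroProb P X)
    {u : EuclideanSpace ℝ (Fin (p + 1))} (hu : ‖u‖ = 1) :
    risk ρ t s F μ₁ μ₂ g P Y X βstar <
      ∫ ω, rayLimit ρ t s F μ₁ μ₂ g u (Y ω, X ω) ∂P := by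
  have h1 := tau_add_risk_le (P := P) (Y := Y) (X := X) (βstar := βstar) hs hA2 hg hB hu
  have h2 : infNonzeroProb P X ≤ P.real {ω | inner ℝ (X ω) u ≠ 0} :=
    ciInf_le bddBelow_range_prob
      (⟨u, by simpa using hu⟩ : Metric.sphere (0 : EuclideanSpace ℝ (Fin (p + 1))) 1)
  have hlm := measurable_limUnder_ray hs hA2 hg hB ht hF u
  have hS : MeasurableSet {ω | inner ℝ (X ω) u ≠ 0} :=
    (hY.prodMk hX) (measurableSet_inner_ne_zero u)
  have hrm : Measurable (rayLimit ρ t s F μ₁ μ₂ g u) :=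
    hlm.indicator (measurableSet_inner_ne_zero u)
  have hri : Integrable (fun ω => rayLimit ρ t s F μ₁ μ₂ g u (Y ω, X ω)) P :=
    Integrable.of_bound (hrm.comp (hY.prodMk hX)).aestronglyMeasurable 1 (ae_of_all _ fun ω => by
      have h := rayLimit_mem_Icc hs hA2 hg hB u (Y ω, X ω)
      rw [Real.norm_of_nonneg h.1]
      exact h.2)
  have hli : Integrable (fun ω => limUnder atTop
      (fun ζ : ℝ => mtLoss ρ t s F μ₁ μ₂ g (Y ω) (ζ * inner ℝ (X ω) u))) P :=
    Integrable.of_bound (hlm.comp (hY.prodMk hX)).aestronglyMeasurable 1 (ae_of_all _ fun ω => by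
      have h := limUnder_ray_mem_Icc hs hA2 hg hB (Y ω) (inner ℝ (X ω) u)
      rw [Real.norm_of_nonneg h.1]
      exact h.2)
  have hSi : Integrable ({ω | inner ℝ (X ω) u ≠ 0}ᶜ.indicator fun _ => (1 : ℝ)) P :=
    (integrable_const 1).indicator hS.compl
  have h3 : ∫ ω, limUnder atTop
        (fun ζ : ℝ => mtLoss ρ t s F μ₁ μ₂ g (Y ω) (ζ * inner ℝ (X ω) u)) ∂P ≤
      ∫ ω, (rayLimit ρ t s F μ₁ μ₂ g u (Y ω, X ω) +
        {ω | inner ℝ (X ω) u ≠ 0}ᶜ.indicator (fun _ => (1 : ℝ)) ω) ∂P := by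
    refine integral_mono hli (hri.add hSi) fun ω => ?_
    by_cases h : inner ℝ (X ω) u = 0
    · simpa [rayLimit, h] using (limUnder_ray_mem_Icc hs hA2 hg hB (Y ω) 0).2
    · simp [rayLimit, h]
  rw [integral_add hri hSi, integral_indicator_const _ hS.compl, smul_eq_mul, mul_one,
    probReal_compl_eq_one_sub hS] at h3
  linarith

/-! ### Consistency -/

/-- Away from `βstar`, the empirical risk eventually stays above some constant larger than the
risk of `βstar`. -/
lemma eventuallyAbove_risk [IsProbabilityMeasure P] (hs : 0 < s)
    (hA2 : MUniqueStrictMono ρ t s F μ₁ μ₂) (hg : IsLink μ₁ μ₂ g) (hB : IsRhoFunction ρ)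
    (ht : Continuous t) (hF : ContinuousOn F (meanRange μ₁ μ₂)) (hY : Measurable Y)
    (hX : Measurable X) (hGLM : FollowsGLM P Y X F μ₁ μ₂ g βstar)
    (hB8 : 1 - tau ρ t s F μ₁ μ₂ g P Y X βstar < infNonzeroProb P X)
    {y : ℕ → Ω → ℝ} {x : ℕ → Ω → EuclideanSpace ℝ (Fin (p + 1))}
    (hindep : iIndepFun (fun (i : ℕ) (ω : Ω) => (y i ω, x i ω)) P)
    (hident : ∀ i, IdentDistrib (fun ω => (y i ω, x i ω)) (fun ω => (Y ω, X ω)) P P)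
    {ε : ℝ} (hε : 0 < ε) :
    EventuallyAbove P (fun i ω => (y i ω, x i ω))
      (fun β z => mtLoss ρ t s F μ₁ μ₂ g z.1 (inner ℝ z.2 β))
      (risk ρ t s F μ₁ μ₂ g P Y X βstar) {β | ε ≤ ‖β - βstar‖} := by
  have hc : ∀ z : ℝ × EuclideanSpace ℝ (Fin (p + 1)),
      Continuous fun β => mtLoss ρ t s F μ₁ μ₂ g z.1 (inner ℝ z.2 β) := fun z =>
    (continuous_mtLoss hA2 hg hB ht hF).comp
      (continuous_const.prodMk (continuous_const.inner continuous_id))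
  have hm := measurable_mtLoss_inner (p := p) hA2 hg hB ht hF
  have hZ₀ : Measurable fun ω => (Y ω, X ω) := hY.prodMk hX
  refine induction_on_complement EventuallyAbove.empty (fun _ _ hA h => h.mono hA)
    (fun _ _ h h' => h.union h') (fun β hβ => ?_) fun u hu => ?_
  · have hne : β - βstar ≠ 0 := norm_pos_iff.1 (hε.trans_le hβ)
    refine exists_eventuallyAbove (fun _ _ => hB.nonneg _) (fun _ _ => hB.le_one _) hc hm hZ₀
      hindep hident (hm β) (fun _ => hB.nonneg _) (fun _ => hB.le_one _)
      (fun z δ hδ => ?_) (risk_lt_risk hA2 hg hB ht hF hY hX hGLM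
        (prob_inner_ne_zero_pos hs hA2 hg hB hB8 hne))
    obtain ⟨r, hr, hβr⟩ := Metric.continuousAt_iff.1 (hc z).continuousAt δ hδ
    filter_upwards [(tendsto_one_div_add_atTop_nhds_zero_nat (𝕜 := ℝ)).eventually_lt_const hr]
      with k hk β' hβ'
    have h := (abs_lt.1 (hβr ((Metric.mem_ball.1 hβ').trans hk))).1
    have h' : mtLoss ρ t s F μ₁ μ₂ g z.1 (inner ℝ z.2 β) - δ ≤
        mtLoss ρ t s F μ₁ μ₂ g z.1 (inner ℝ z.2 β') := by linarith
    exact h'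
  · exact exists_eventuallyAbove (fun _ _ => hB.nonneg _) (fun _ _ => hB.le_one _) hc hm hZ₀
      hindep hident
      ((measurable_limUnder_ray hs hA2 hg hB ht hF u).indicator (measurableSet_inner_ne_zero u))
      (fun z => (rayLimit_mem_Icc hs hA2 hg hB u z).1)
      (fun z => (rayLimit_mem_Icc hs hA2 hg hB u z).2)
      (fun z δ hδ => rayLimit_sub_le hs hA2 hg hB u z hδ)
      (risk_lt_integral_rayLimit hs hA2 hg hB ht hF hY hX hB8 hu)

end Regression

end PenMT

open PenMT

theorem theorem1
    {Ω : Type*} [MeasurableSpace Ω] (P : Measure Ω) [IsProbabilityMeasure P] (p : ℕ)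
    -- the family of response laws, the known scale parameter, the link, `t` and `ρ`
    (μ₁ μ₂ : EReal) (F : ℝ → ℝ → ProbabilityMeasure ℝ) (φ : ℝ) (hφ : 0 < φ)
    (a : ℝ → ℝ) (ha : 0 < a φ)
    (g : ℝ → ℝ) (hg : PenMT.IsLink μ₁ μ₂ g)
    (t ρ : ℝ → ℝ)
    -- the true parameter, a generic pair, the sample
    (βstar : EuclideanSpace ℝ (Fin (p + 1)))
    (Y : Ω → ℝ) (X : Ω → EuclideanSpace ℝ (Fin (p + 1)))
    (hY : Measurable Y) (hX : Measurable X)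
    (hGLM : PenMT.FollowsGLM P Y X (fun μ => F μ φ) μ₁ μ₂ g βstar)
    (y : ℕ → Ω → ℝ) (x : ℕ → Ω → EuclideanSpace ℝ (Fin (p + 1)))
    (hy : ∀ i, Measurable (y i)) (hx : ∀ i, Measurable (x i))
    (hindep : iIndepFun (fun (i : ℕ) (ω : Ω) => (y i ω, x i ω)) P)
    (hident : ∀ i, IdentDistrib (fun ω => (y i ω, x i ω)) (fun ω => (Y ω, X ω)) P P)
    -- A1 - A5
    (hA1 : PenMT.supVar t (fun μ => F μ φ) μ₁ μ₂ < ⊤)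
    (hA2 : PenMT.MUniqueStrictMono ρ t (a φ) (fun μ => F μ φ) μ₁ μ₂)
    (hA3 : ContinuousOn (fun μ => F μ φ) (PenMT.meanRange μ₁ μ₂))
    (hA4 : ∀ ν₁ ∈ PenMT.meanRange μ₁ μ₂, ∀ ν₂ ∈ PenMT.meanRange μ₁ μ₂, ν₁ < ν₂ →
      ∀ c : ℝ, (F ν₂ φ : Measure ℝ) (Set.Iic c) ≤ (F ν₁ φ : Measure ℝ) (Set.Iic c))
    (hA5 : StrictMono t ∧ Continuous t)
    -- B1 - B6 and B8
    (hB : PenMT.IsRhoFunction ρ)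
    (hB6 : ∃ η : ℝ, 0 < η ∧ ρ (√(PenMT.supVar t (fun μ => F μ φ) μ₁ μ₂).toReal + η) < 1)
    (hB8 : 1 - PenMT.tau ρ t (a φ) (fun μ => F μ φ) μ₁ μ₂ g P Y X βstar
      < PenMT.infNonzeroProb P X)
    -- the penalty and its (possibly random) parameters
    (pen : ℝ → EuclideanSpace ℝ (Fin (p + 1)) → ℝ → ℝ) (lam alpha : ℕ → Ω → ℝ)
    (hpen : ∀ᵐ ω ∂P, ∀ n : ℕ, 1 ≤ n → ∀ β, 0 ≤ pen (lam n ω) β (alpha n ω))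
    (hpen_star : ∀ᵐ ω ∂P, Tendsto (fun n => pen (lam n ω) βstar (alpha n ω)) atTop (𝓝 0))
    -- the penalized MT-estimators
    (βhat : ℕ → Ω → EuclideanSpace ℝ (Fin (p + 1)))
    (hβhat : ∀ᵐ ω ∂P, ∀ n : ℕ, 1 ≤ n →
      IsMinOn (fun β => PenMT.empRisk ρ t (a φ) (fun μ => F μ φ) μ₁ μ₂ g y x n ω β
        + pen (lam n ω) β (alpha n ω)) Set.univ (βhat n ω)) :
    ∀ᵐ ω ∂P, Tendsto (fun n => βhat n ω) atTop (𝓝 βstar) := by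
  obtain ⟨-, ht⟩ := hA5
  have habove := fun j : ℕ => eventuallyAbove_risk ha hA2 hg hB ht hA3 hY hX hGLM hB8 hindep hident
    (show (0 : ℝ) < 1 / ((j : ℝ) + 1) by positivity)
  choose c' hc' habove using habove
  have hm := measurable_mtLoss_inner hA2 hg hB ht hA3 βstar
  have hstar := tendsto_average hindep hident hm (Integrable.of_bound
    (hm.comp (hY.prodMk hX)).aestronglyMeasurable 1 (ae_of_all _ fun ω => hB.norm_le_one _))
  filter_upwards [ae_all_iff.2 habove, hstar, hpen, hpen_star, hβhat]
    with ω habove hstar hpen hpen_star hβhat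
  rw [Metric.tendsto_nhds]
  intro ε hε
  obtain ⟨j, hj⟩ := exists_nat_one_div_lt hε
  have hsum := hstar.add hpen_star
  rw [add_zero] at hsum
  filter_upwards [habove j, hsum.eventually_lt_const (hc' j), eventually_ge_atTop 1]
    with n hn hlt hn1
  rw [dist_eq_norm]
  by_contra! hge
  -- The penalized objective at `βhat n` is at most its value at `βstar`, which tends to the
  -- risk of `βstar`.
  have h2 := hn (βhat n ω) (hj.le.trans hge)
  have h3 := hβhat n hn1 (Set.mem_univ βstar)
  have h4 := hpen n hn1 (βhat n ω)
  simp only [Set.mem_ofPred_eq, empRisk] at h3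
  linarith
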